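/- \textbf{Theorem.} Let $\mathcal V$ be a pointed variety of (finitary) universal algebras, that is, a class of algebras of a fixed type defined by identities which has a unique constant $0$: there is a closed term $0$, and every closed term is equal to $0$ in all algebras of $\mathcal V$. Regard $\mathcal V$ as a category whose morphisms are the homomorphisms. Then the following are equivalent. (P) For any two coequalizer diagrams $C_1 \underset{v}{\overset{u}{\rightrightarrows}} X \xrightarrow{q_1} X'$ and $C_2 \underset{v'}{\overset{u'}{\rightrightarrows}} Y \xrightarrow{q_2} Y'$ in $\mathcal V$, the diagram $$C_1\times C_2 \underset{v\times v'}{\overset{u\times u'}{\rightrightarrows}} X\times Y \xrightarrow{q_1\times q_2} X'\times Y'$$ is a coequalizer diagram in $\mathcal V$. (T) There are integers $m\ge 0$ and $n\ge 1$, binary terms $b_1,\dots,b_m$, unary terms $c_1,\dots,c_m$ and $(m+2)$-ary terms $p_1,\dots,p_n$ of $\mathcal V$ such that the following identities hold in every algebra of $\mathcal V$: \begin{align*} p_1(x,y,b_1(x,y),\dots,b_m(x,y)) &= x,\\ p_i(y,x,b_1(x,y),\dots,b_m(x,y)) &= p_{i+1}(x,y,b_1(x,y),\dots,b_m(x,y))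 && (1\le i<n),\\ p_n(y,x,b_1(x,y),\dots,b_m(x,y)) &= y,\\ p_i(0,0,c_1(z),\dots,c_m(z)) &= z && (1\le i\le n). \end{align*} -/

import Mathlib

open CategoryTheory CategoryTheory.Limits
open scoped FirstOrder

universe u v w

/-- A variety of universal algebras of type `L` (a first-order language, used with no relation
symbols), presented by a set of identities `s ≈ t` between terms in countably many variables. -/
structure Variety (L : FirstOrder.Language.{u, v}) where
  /-- The defining identities. -/
  identities : Set (L.Term ℕ × L.Term ℕ)

namespace Variety

variable {L : FirstOrder.Language.{u, v}}

/-- An algebra of the variety `V`: an `L`-structure in which all identities of `V` hold.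
The carrier universe is large enough to contain the terms of `L`. -/
structure Alg (V : Variety L) where
  /-- The underlying set. -/
  carrier : Type (max u w)
  /-- The basic operations. -/
  [str : L.Structure carrier]
  /-- The identities of the variety hold for all values of the variables. -/
  holds : ∀ e ∈ V.identities, ∀ x : ℕ → carrier, e.1.realize x = e.2.realize x

attribute [instance] Alg.str

instance (V : Variety L) : CoeSort (Alg.{u, v, w} V) (Type (max u w)) := ⟨Alg.carrier⟩

/-- A variety as a category: the morphisms are all homomorphisms of algebras. -/
instance (V : Variety L) : Category (Alg.{u, v, w} V) where
  Hom A B := A →[L] B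
  id A := FirstOrder.Language.Hom.id L A
  comp f g := g.comp f

/-- The product algebra, with operations computed coordinatewise. -/
def prodAlg {V : Variety L} (A B : Alg.{u, v, w} V) : Alg.{u, v, w} V :=
  letI : L.Structure (A × B) :=
    { funMap := fun f x => (FirstOrder.Language.Structure.funMap f fun i => (x i).1,
        FirstOrder.Language.Structure.funMap f fun i => (x i).2)
      RelMap := fun r x => FirstOrder.Language.Structure.RelMap r (fun i => (x i).1) ∧
        FirstOrder.Language.Structure.RelMap r (fun i => (x i).2) }
  { carrier := A × B
    holds := by
      intro e he x
      let p₁ : (A × B) →[L] A := { toFun := Prod.fst, map_fun' := fun _ _ => rfl,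
                                   map_rel' := fun _ _ h => h.1 }
      let p₂ : (A × B) →[L] B := { toFun := Prod.snd, map_fun' := fun _ _ => rfl,
                                   map_rel' := fun _ _ h => h.2 }
      apply Prod.ext
      · change p₁ _ = p₁ _
        rw [← FirstOrder.Language.HomClass.realize_term, ← FirstOrder.Language.HomClass.realize_term]
        exact A.holds e he _
      · change p₂ _ = p₂ _
        rw [← FirstOrder.Language.HomClass.realize_term, ← FirstOrder.Language.HomClass.realize_term]
        exact B.holds e he _ }

/-- First projection of the product algebra. -/
def prodFst {V : Variety L} (A B : Alg.{u, v, w} V) : prodAlg A B ⟶ A :=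
  ({ toFun := fun x : A × B => x.1, map_fun' := fun _ _ => rfl, map_rel' := fun _ _ h => h.1 } :
    (prodAlg A B) →[L] A)

/-- Second projection of the product algebra. -/
def prodSnd {V : Variety L} (A B : Alg.{u, v, w} V) : prodAlg A B ⟶ B :=
  ({ toFun := fun x : A × B => x.2, map_fun' := fun _ _ => rfl, map_rel' := fun _ _ h => h.2 } :
    (prodAlg A B) →[L] B)

/-- The homomorphism into the product algebra with given coordinates. -/
def prodLift {V : Variety L} {A B T : Alg.{u, v, w} V} (f : T ⟶ A) (g : T ⟶ B) :
    T ⟶ prodAlg A B :=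
  letI f' : T →[L] A := f
  letI g' : T →[L] B := g
  ({ toFun := fun t => ((f' t, g' t) : A × B)
     map_fun' := fun φ x => Prod.ext (f'.map_fun' φ x) (g'.map_fun' φ x)
     map_rel' := fun r x h => ⟨f'.map_rel' r x h, g'.map_rel' r x h⟩ } : T →[L] (prodAlg A B))

/-- The product algebra is a categorical product. -/
def prodIsLimit {V : Variety L} (A B : Alg.{u, v, w} V) :
    IsLimit (BinaryFan.mk (prodFst A B) (prodSnd A B)) :=
  BinaryFan.isLimitMk (fun s => prodLift s.fst s.snd) (fun _ => rfl) (fun _ => rfl) (by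
    intro s m h₁ h₂
    refine FirstOrder.Language.Hom.ext fun t => Prod.ext ?_ ?_
    · exact congrArg (fun k : s.pt →[L] A => k t) h₁
    · exact congrArg (fun k : s.pt →[L] B => k t) h₂)

instance (V : Variety L) : HasBinaryProducts (Alg.{u, v, w} V) := by
  have : ∀ A B : Alg.{u, v, w} V, HasLimit (pair A B) :=
    fun A B => HasLimit.mk ⟨_, prodIsLimit A B⟩
  exact hasBinaryProducts_of_hasLimit_pair _

/-- `o` is the unique constant of `V`: every closed term is equal to `o` in all algebras of `V`.
A variety is pointed if it has such a constant. -/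
def IsUniqueConstant (V : Variety L) (o : L.Term Empty) : Prop :=
  ∀ t : L.Term Empty, ∀ A : Alg.{u, v, w} V,
    t.realize (Empty.elim : Empty → A) = o.realize (Empty.elim : Empty → A)

/-- The element of the algebra `A` named by the closed term `o`. -/
def const {V : Variety L} (o : L.Term Empty) (A : Alg.{u, v, w} V) : A :=
  o.realize (Empty.elim : Empty → A)

end Variety

/-- The diagram `K ⇉ X → Q` given by `f`, `g` and `q` is a coequalizer diagram. -/
def IsCoequalizerDiagram {C : Type u} [Category.{v} C] {K X Q : C}
    (f g : K ⟶ X) (q : X ⟶ Q) : Prop :=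
  ∃ h : f ≫ q = g ≫ q, Nonempty (IsColimit (Cofork.ofπ q h))

/-- Property (P): the product of any two coequalizer diagrams is a coequalizer diagram. -/
def ProductsPreserveCoequalizers (C : Type u) [Category.{v} C] [HasBinaryProducts C] : Prop :=
  ∀ ⦃C₁ X X' C₂ Y Y' : C⦄ (f g : C₁ ⟶ X) (q₁ : X ⟶ X') (f' g' : C₂ ⟶ Y) (q₂ : Y ⟶ Y'),
    IsCoequalizerDiagram f g q₁ → IsCoequalizerDiagram f' g' q₂ →
      IsCoequalizerDiagram (prod.map f f') (prod.map g g') (prod.map q₁ q₂)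

/-!
That the terms imply property (P) rests on the fact that a coequalizer of algebras is a surjection
`q` such that every homomorphism identifying the parallel pair is constant on the fibres of `q`
(`Variety.isCoequalizerDiagram_iff`). Let `h` on `X × Y` identify the product pair. Then `h (-, 0)`
identifies the first pair, so `q₁ x = q₁ x'` gives `h (x, 0) = h (x', 0)`. Applying the terms `pᵢ` to
`(x, 0)`, `(x', 0)` and the pairs `(bⱼ (x, x'), cⱼ y)` yields a chain of equalities from `h (x, y)`
to `h (x', y)` (`Variety.toHom_eq_of_terms`). The second coordinate is treated in the same way.

For the converse, let `x, y` and `z` be the generators of the free algebras `F₂` and `F₁`. Property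
(P) applies to the coequalizer diagrams `F₁ ⇉ F₂ → F₁`, identifying `x` and `y`, and
`F₁ ⇉ F₁ → F₁`, with the zero map twice and the identity. It says that `((x, z), (y, z))` lies in
the congruence on `F₂ × F₁` generated by `((x, 0), (y, 0))`
(`Variety.swapSetoid_of_productsPreserveCoequalizers`). In Maltsev's description that congruence
consists of chains whose steps have the form `p (α, β, d)`, `p (β, α, d)` with a term `p` and
parameters `d`, where `α = (x, 0)` and `β = (y, 0)`. The terms of such a chain are the `pᵢ`, and the
coordinates of the parameters are terms `bⱼ` in `x, y` and `cⱼ` in `z`.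
-/

/-! ### Coequalizer diagrams up to isomorphism -/

theorem isCoequalizerDiagram_iff_existsUnique {C : Type u} [Category.{v} C] {K X Q : C}
    {f g : K ⟶ X} {q : X ⟶ Q} :
    IsCoequalizerDiagram f g q ↔
      f ≫ q = g ≫ q ∧ ∀ ⦃Z : C⦄ (h : X ⟶ Z), f ≫ h = g ≫ h → ∃! k : Q ⟶ Z, q ≫ k = h := by
  constructor
  · rintro ⟨hq, ⟨hl⟩⟩
    refine ⟨hq, fun Z h hh => ?_⟩
    obtain ⟨k, hk⟩ := Cofork.IsColimit.desc' hl h hh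
    exact ⟨k, hk, fun k' hk' => Cofork.IsColimit.hom_ext hl (hk'.trans hk.symm)⟩
  · rintro ⟨hq, hu⟩
    exact ⟨hq, ⟨Cofork.IsColimit.ofExistsUnique fun s => hu s.π s.condition⟩⟩

theorem IsCoequalizerDiagram.of_iso {C : Type u} [Category.{v} C] {K X Q K' X' Q' : C}
    {f g : K ⟶ X} {q : X ⟶ Q} {f' g' : K' ⟶ X'} {q' : X' ⟶ Q'}
    (eK : K ≅ K') (eX : X ≅ X') (eQ : Q ≅ Q')
    (hf : f ≫ eX.hom = eK.hom ≫ f') (hg : g ≫ eX.hom = eK.hom ≫ g')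
    (hq : q ≫ eQ.hom = eX.hom ≫ q') (h : IsCoequalizerDiagram f g q) :
    IsCoequalizerDiagram f' g' q' := by
  rw [isCoequalizerDiagram_iff_existsUnique] at h ⊢
  obtain ⟨hc, hu⟩ := h
  constructor
  · rw [← cancel_epi eK.hom, ← Category.assoc, ← Category.assoc, ← hf, ← hg, Category.assoc,
      Category.assoc, ← hq, reassoc_of% hc]
  · intro Z h hh
    have key : f ≫ eX.hom ≫ h = g ≫ eX.hom ≫ h := by
      rw [reassoc_of% hf, reassoc_of% hg, hh]
    obtain ⟨k, hk, hk'⟩ := hu _ key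
    refine ⟨eQ.inv ≫ k, ?_, fun l hl => ?_⟩
    · have hq' : q' ≫ eQ.inv = eX.inv ≫ q := by
        rw [Iso.comp_inv_eq, Category.assoc, hq, Iso.inv_hom_id_assoc]
      change q' ≫ eQ.inv ≫ k = h
      rw [reassoc_of% hq', hk, Iso.inv_hom_id_assoc]
    · rw [Iso.eq_inv_comp]
      apply hk'
      rw [reassoc_of% hq, hl]

namespace Variety

open FirstOrder.Language FirstOrder.Language.Structure

variable {L : FirstOrder.Language.{u, v}} {V : Variety L}

/-! ### Homomorphisms, the constant and products, elementwise -/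

/-- A morphism of the category of algebras, viewed as a homomorphism of structures. -/
def toHom {A B : Alg.{u, v, w} V} (f : A ⟶ B) : A →[L] B := f

@[simp] theorem toHom_comp {A B C : Alg.{u, v, w} V} (f : A ⟶ B) (g : B ⟶ C) (a : A) :
    toHom (f ≫ g) a = toHom g (toHom f a) := rfl

@[simp] theorem toHom_id {A : Alg.{u, v, w} V} (a : A) : toHom (𝟙 A) a = a := rfl

theorem toHom_injective {A B : Alg.{u, v, w} V} {f g : A ⟶ B}
    (h : ∀ a, toHom f a = toHom g a) : f = g :=
  FirstOrder.Language.Hom.ext h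

theorem toHom_realize {A B : Alg.{u, v, w} V} (f : A ⟶ B) {α : Type*} (t : L.Term α)
    (x : α → A) : toHom f (t.realize x) = t.realize fun i => toHom f (x i) :=
  (FirstOrder.Language.HomClass.realize_term (toHom f)).symm

theorem toHom_funMap {A B : Alg.{u, v, w} V} (f : A ⟶ B) {n : ℕ} (φ : L.Functions n)
    (x : Fin n → A) : toHom f (funMap φ x) = funMap φ fun i => toHom f (x i) :=
  (toHom f).map_fun' φ x

theorem toHom_const {A B : Alg.{u, v, w} V} (f : A ⟶ B) (o : L.Term Empty) :
    toHom f (const o A) = const o B := by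
  rw [const, toHom_realize, const]
  congr 1
  exact funext fun e => e.elim

theorem funMap_const {o : L.Term Empty} (ho : IsUniqueConstant.{u, v, w} V o)
    (A : Alg.{u, v, w} V) {n : ℕ} (φ : L.Functions n) :
    funMap φ (fun _ => const o A) = const o A :=
  ho (Term.func φ fun _ => o) A

theorem realize_const {o : L.Term Empty} (ho : IsUniqueConstant.{u, v, w} V o)
    (A : Alg.{u, v, w} V) {α : Type*} (t : L.Term α) :
    (t.realize fun _ => const o A) = const o A := by
  induction t with
  | var => rfl
  | func φ ts ih =>
    rw [Term.realize_func]
    simp only [ih, funMap_const ho]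

theorem realize_prodAlg {A B : Alg.{u, v, w} V} {α : Type*} (t : L.Term α)
    (x : α → prodAlg A B) :
    t.realize x = (t.realize fun i => (x i).1, t.realize fun i => (x i).2) :=
  Prod.ext (toHom_realize (prodFst A B) t x) (toHom_realize (prodSnd A B) t x)

/-- The product of two homomorphisms, between the product algebras. -/
def prodMap {A B A' B' : Alg.{u, v, w} V} (f : A ⟶ A') (g : B ⟶ B') :
    prodAlg A B ⟶ prodAlg A' B' :=
  prodLift (prodFst A B ≫ f) (prodSnd A B ≫ g)

/-- The categorical product is isomorphic to the product algebra. -/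
noncomputable def prodIso (A B : Alg.{u, v, w} V) : A ⨯ B ≅ prodAlg A B :=
  (limit.isLimit (pair A B)).conePointUniqueUpToIso (prodIsLimit A B)

theorem prodIso_hom (A B : Alg.{u, v, w} V) : (prodIso A B).hom = prodLift prod.fst prod.snd :=
  rfl

theorem prodMap_comp_prodIso {A B A' B' : Alg.{u, v, w} V} (f : A ⟶ A') (g : B ⟶ B') :
    prod.map f g ≫ (prodIso A' B').hom = (prodIso A B).hom ≫ prodMap f g := by
  rw [prodIso_hom, prodIso_hom]
  refine toHom_injective fun a => Prod.ext ?_ ?_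
  · exact congrArg (fun k => toHom k a) (prod.map_fst f g)
  · exact congrArg (fun k => toHom k a) (prod.map_snd f g)

/-- A product of coequalizer diagrams may be computed with the product algebras. -/
theorem isCoequalizerDiagram_prodMap_iff {C₁ X X' C₂ Y Y' : Alg.{u, v, w} V} (f g : C₁ ⟶ X)
    (q₁ : X ⟶ X') (f' g' : C₂ ⟶ Y) (q₂ : Y ⟶ Y') :
    IsCoequalizerDiagram (prod.map f f') (prod.map g g') (prod.map q₁ q₂) ↔
      IsCoequalizerDiagram (prodMap f f') (prodMap g g') (prodMap q₁ q₂) := by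
  constructor
  · exact IsCoequalizerDiagram.of_iso (prodIso _ _) (prodIso _ _) (prodIso _ _)
      (prodMap_comp_prodIso _ _) (prodMap_comp_prodIso _ _) (prodMap_comp_prodIso _ _)
  · refine IsCoequalizerDiagram.of_iso (prodIso _ _).symm (prodIso _ _).symm (prodIso _ _).symm
      ?_ ?_ ?_ <;>
    · rw [Iso.symm_hom, Iso.symm_hom, Iso.comp_inv_eq, Category.assoc, prodMap_comp_prodIso,
        Iso.inv_hom_id_assoc]

/-! ### From the terms to products of coequalizers -/

/-- The heart of the implication from the terms to the exactness property: a homomorphism `h` on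
a product that identifies `(x, 0)` and `(x', 0)` identifies `(x, y)` and `(x', y)` for every `y`.
The term `p i`, evaluated at `(x, 0)`, `(x', 0)` and the pairs `(b j (x, x'), c j y)`, has second
coordinate `y`, and its value under `h` does not change when `(x, 0)` and `(x', 0)` are swapped;
the first coordinates run from `x` to `x'`. -/
theorem toHom_eq_of_terms (o : L.Term Empty) {m n : ℕ} (b : Fin m → L.Term (Fin 2))
    (c : Fin m → L.Term (Fin 1)) (p : Fin (n + 1) → L.Term (Fin (m + 2)))
    {A B Z : Alg.{u, v, w} V}
    (h0 : ∀ x y : A, (p 0).realize (Matrix.vecCons x (Matrix.vecCons y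
      fun j => (b j).realize ![x, y])) = x)
    (hstep : ∀ (i : Fin n) (x y : A),
      (p i.castSucc).realize (Matrix.vecCons y (Matrix.vecCons x
          fun j => (b j).realize ![x, y])) =
        (p i.succ).realize (Matrix.vecCons x (Matrix.vecCons y
          fun j => (b j).realize ![x, y])))
    (hlast : ∀ x y : A, (p (Fin.last n)).realize (Matrix.vecCons y (Matrix.vecCons x
      fun j => (b j).realize ![x, y])) = y)
    (hc : ∀ (i : Fin (n + 1)) (z : B), (p i).realize (Matrix.vecCons (const o B)
      (Matrix.vecCons (const o B) fun j => (c j).realize ![z])) = z)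
    (h : prodAlg A B ⟶ Z) {x x' : A}
    (hx : toHom h (x, const o B) = toHom h (x', const o B)) (y : B) :
    toHom h (x, y) = toHom h (x', y) := by
  have hpair : ∀ (i : Fin (n + 1)) (s t : A),
      (((p i).realize (Matrix.vecCons s (Matrix.vecCons t fun j => (b j).realize ![x, x'])), y) :
        A × B) = (p i).realize (M := prodAlg A B) (Matrix.vecCons (s, const o B)
          (Matrix.vecCons (t, const o B)
            fun j => ((b j).realize ![x, x'], (c j).realize ![y]))) := by
    intro i s t
    rw [realize_prodAlg]
    refine Prod.ext ?_ ?_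
    · refine congrArg (fun a => (p i).realize a) (funext fun k => ?_)
      exact Fin.cases rfl (fun k => Fin.cases rfl (fun k => rfl) k) k
    · refine (hc i y).symm.trans (congrArg (fun a => (p i).realize a) (funext fun k => ?_))
      exact Fin.cases rfl (fun k => Fin.cases rfl (fun k => rfl) k) k
  have hswap : ∀ i : Fin (n + 1),
      toHom h ((p i).realize (Matrix.vecCons x (Matrix.vecCons x'
        fun j => (b j).realize ![x, x'])), y) =
      toHom h ((p i).realize (Matrix.vecCons x' (Matrix.vecCons x
        fun j => (b j).realize ![x, x'])), y) := by
    intro i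
    rw [hpair, hpair, toHom_realize, toHom_realize]
    congr 1
    funext k
    refine Fin.cases hx (fun k => Fin.cases hx.symm (fun k => rfl) k) k
  have hchain : ∀ i : Fin (n + 1), toHom h (x, y) =
      toHom h ((p i).realize (Matrix.vecCons x (Matrix.vecCons x'
        fun j => (b j).realize ![x, x'])), y) := by
    intro i
    induction i using Fin.induction with
    | zero => rw [h0]
    | succ i ih => rw [ih, hswap, hstep]
  rw [hchain (Fin.last n), hswap, hlast]

/-! ### The congruence generated by a pair -/

section Swap

variable {A : Alg.{u, v, w} V} (α β : A)

/-- `w'` arises from `w` by swapping `α` and `β` in some expression of `w` by a term with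
parameters from `A`. -/
def SwapRel (w w' : A) : Prop :=
  ∃ p : L.Term (A ⊕ Fin 2),
    p.realize (Sum.elim id ![α, β]) = w ∧ p.realize (Sum.elim id ![β, α]) = w'

variable {α β}

theorem SwapRel.refl (w : A) : SwapRel α β w w := ⟨Term.var (Sum.inl w), rfl, rfl⟩

theorem SwapRel.symm {w w' : A} (h : SwapRel α β w w') : SwapRel α β w' w := by
  obtain ⟨p, rfl, rfl⟩ := h
  refine ⟨p.relabel (Sum.map id (Equiv.swap 0 1)), ?_, ?_⟩ <;>
  · rw [Term.realize_relabel]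
    congr 1
    funext i
    rcases i with a | i
    · rfl
    · fin_cases i <;> rfl

theorem SwapRel.funMap {n : ℕ} (φ : L.Functions n) {x y : Fin n → A}
    (h : ∀ i, SwapRel α β (x i) (y i)) : SwapRel α β (funMap φ x) (funMap φ y) := by
  choose p hp hp' using h
  refine ⟨Term.func φ p, ?_, ?_⟩
  · rw [Term.realize_func]; simp only [hp]
  · rw [Term.realize_func]; simp only [hp']

variable (α β)

/-- The congruence generated by `(α, β)`: the transitive closure of `SwapRel α β`. Chains are
encoded as eventually constant sequences, so that finitely many of them can be combined
termwise. -/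
def swapSetoid : Setoid A where
  r w w' := ∃ s : ℕ → A, s 0 = w ∧ (∀ i, SwapRel α β (s i) (s (i + 1))) ∧
    ∃ N, ∀ i, N ≤ i → s i = w'
  iseqv := by
    refine ⟨fun w => ⟨fun _ => w, rfl, fun _ => .refl w, 0, fun _ _ => rfl⟩, ?_, ?_⟩
    · rintro w w' ⟨s, h0, hs, N, hN⟩
      refine ⟨fun i => s (N - i), hN _ le_rfl, fun i => ?_, N, fun i hi => ?_⟩
      · rcases lt_or_ge i N with hi | hi
        · have := (hs (N - (i + 1))).symm
          rwa [show N - (i + 1) + 1 = N - i by omega] at this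
        · dsimp only
          rw [show N - (i + 1) = N - i by omega]
          exact .refl _
      · dsimp only
        rw [Nat.sub_eq_zero_of_le hi, h0]
    · rintro w w' w'' ⟨s, h0, hs, N, hN⟩ ⟨t, k0, ht, M, hM⟩
      refine ⟨fun i => if i ≤ N then s i else t (i - N), by simp [h0], fun i => ?_, N + M + 1,
        fun i hi => ?_⟩
      · dsimp only
        rcases lt_trichotomy i N with hi | rfl | hi
        · rw [if_pos hi.le, if_pos (by omega)]
          exact hs i
        · rw [if_pos le_rfl, if_neg (by omega), hN _ le_rfl, ← k0, show i + 1 - i = 0 + 1 by omega]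
          exact ht 0
        · rw [if_neg (by omega), if_neg (by omega), show i + 1 - N = i - N + 1 by omega]
          exact ht _
      · dsimp only
        rw [if_neg (by omega)]
        exact hM _ (by omega)

theorem swapSetoid_funMap ⦃n : ℕ⦄ (φ : L.Functions n) (x y : Fin n → A)
    (h : ∀ i, swapSetoid α β (x i) (y i)) : swapSetoid α β (funMap φ x) (funMap φ y) := by
  choose s h0 hs N hN using h
  refine ⟨fun i => funMap φ fun k => s k i, by simp only [h0],
    fun i => SwapRel.funMap φ fun k => hs k i, Finset.univ.sup N, fun i hi => ?_⟩
  simp only [fun k => hN k i ((Finset.le_sup (Finset.mem_univ k)).trans hi)]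

variable {α β}

theorem SwapRel.swapSetoid {w w' : A} (h : SwapRel α β w w') : swapSetoid α β w w' := by
  refine ⟨fun i => if i = 0 then w else w', rfl, fun i => ?_, 1, fun i hi => ?_⟩
  · rcases i with _ | i
    · exact h
    · exact .refl w'
  · exact if_neg (by omega)

end Swap

/-- Finitely many terms with parameters from a structure have a common finite list of
parameters. -/
theorem exists_common_parameters {M : Type*} [L.Structure M] {n : ℕ}
    (p : Fin n → L.Term (M ⊕ Fin 2)) :
    ∃ (m : ℕ) (d : Fin m → M) (p' : Fin n → L.Term (Fin (m + 2))), ∀ (i : Fin n) (a b : M),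
      (p' i).realize (Matrix.vecCons a (Matrix.vecCons b d)) =
        (p i).realize (Sum.elim id ![a, b]) := by
  classical
  let D : Finset M := Finset.univ.biUnion fun i => (p i).varFinsetLeft
  have hD : ∀ i, ∀ a ∈ (p i).varFinsetLeft, a ∈ D := fun i a ha =>
    Finset.mem_biUnion.2 ⟨i, Finset.mem_univ i, ha⟩
  refine ⟨D.card, fun j => (D.equivFin.symm j : M), fun i =>
    ((p i).restrictVarLeft fun a => D.equivFin ⟨a, hD i a a.2⟩).relabel
      (Sum.elim (fun j => j.succ.succ) ![0, 1]), fun i a b => ?_⟩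
  rw [Term.realize_relabel, Term.realize_restrictVarLeft id]
  · congr 1
    funext k
    rcases k with k | k
    · rfl
    · fin_cases k <;> rfl
  · intro x
    simp

/-! ### Algebras: operations without relations -/

variable [L.IsAlgebraic]

/-- A function that commutes with the basic operations is a homomorphism, as there are no
relation symbols. -/
def ofFun {A B : Alg.{u, v, w} V} (f : A → B)
    (hf : ∀ ⦃n : ℕ⦄ (φ : L.Functions n) (x : Fin n → A),
      f (funMap φ x) = funMap φ fun i => f (x i)) : A ⟶ B :=
  ({ toFun := f
     map_fun' := fun φ x => hf φ x
     map_rel' := fun r => isEmptyElim r } : A →[L] B)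

/-- The zero homomorphism, with constant value the unique constant. -/
def zeroHom {o : L.Term Empty} (ho : IsUniqueConstant.{u, v, w} V o) (A B : Alg.{u, v, w} V) :
    A ⟶ B :=
  ofFun (fun _ => const o B) fun _ φ _ => (funMap_const ho B φ).symm

/-! ### Coequalizer diagrams of algebras -/

/-- A subalgebra, as an algebra of the variety. -/
def subAlg (A : Alg.{u, v, w} V) (S : L.Substructure A) : Alg.{u, v, w} V where
  carrier := S
  holds e he x := by
    apply Subtype.ext
    change S.subtype _ = S.subtype _
    rw [← FirstOrder.Language.HomClass.realize_term, ← FirstOrder.Language.HomClass.realize_term]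
    exact A.holds e he _

/-- The inclusion of a subalgebra. -/
def subAlgIncl (A : Alg.{u, v, w} V) (S : L.Substructure A) : subAlg A S ⟶ A :=
  ofFun (fun x : S => (x : A)) fun _ _ _ => rfl

/-- The corestriction of a homomorphism to a subalgebra containing its image. -/
def subAlgLift {A B : Alg.{u, v, w} V} (f : B ⟶ A) (S : L.Substructure A)
    (h : ∀ b, toHom f b ∈ S) : B ⟶ subAlg A S :=
  ofFun (fun b => (⟨toHom f b, h b⟩ : S)) fun _ φ x => Subtype.ext (toHom_funMap f φ x)

theorem subAlgLift_comp_incl {A B : Alg.{u, v, w} V} (f : B ⟶ A) (S : L.Substructure A)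
    (h : ∀ b, toHom f b ∈ S) : subAlgLift f S h ≫ subAlgIncl A S = f := rfl

theorem exists_factor_of_surjective {X Q Z : Alg.{u, v, w} V} {q : X ⟶ Q}
    (hq : Function.Surjective (toHom q)) {h : X ⟶ Z}
    (hh : ∀ x x', toHom q x = toHom q x' → toHom h x = toHom h x') : ∃ k : Q ⟶ Z, q ≫ k = h := by
  choose s hs using hq
  refine ⟨ofFun (fun y => toHom h (s y)) fun n φ y => ?_, toHom_injective fun x => hh _ _ (hs _)⟩
  rw [← toHom_funMap]
  apply hh
  rw [hs, toHom_funMap]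
  simp only [hs]

/-- A coequalizer of algebras is a surjection `q` such that every homomorphism identifying the
parallel pair is constant on the fibres of `q`. Surjectivity holds because the image of `q`
satisfies the same universal property. -/
theorem isCoequalizerDiagram_iff {K X Q : Alg.{u, v, w} V} {f g : K ⟶ X} {q : X ⟶ Q} :
    IsCoequalizerDiagram f g q ↔ f ≫ q = g ≫ q ∧ Function.Surjective (toHom q) ∧
      ∀ ⦃Z : Alg.{u, v, w} V⦄ (h : X ⟶ Z), f ≫ h = g ≫ h →
        ∀ x x', toHom q x = toHom q x' → toHom h x = toHom h x' := by
  rw [isCoequalizerDiagram_iff_existsUnique]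
  refine and_congr_right fun hc => ⟨fun hu => ⟨fun y => ?_, fun Z h hh x x' hx => ?_⟩,
    fun ⟨hs, hu⟩ Z h hh => ?_⟩
  · let S := (toHom q).range
    have hS : ∀ x, toHom q x ∈ S := fun x => ⟨x, rfl⟩
    obtain ⟨k, hk, -⟩ := hu (subAlgLift q S hS)
      (toHom_injective fun c => Subtype.ext (congrArg (fun k => toHom k c) hc))
    have hk' : k ≫ subAlgIncl Q S = 𝟙 Q := by
      refine (hu q hc).unique ?_ (Category.comp_id q)
      change q ≫ k ≫ subAlgIncl Q S = q
      rw [← Category.assoc, show q ≫ k = _ from hk, subAlgLift_comp_incl]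
    obtain ⟨x, hx⟩ := (show S from toHom k y).2
    exact ⟨x, hx.trans (congrArg (fun k => toHom k y) hk')⟩
  · obtain ⟨k, rfl, -⟩ := hu h hh
    simp [hx]
  · obtain ⟨k, hk⟩ := exists_factor_of_surjective hs (hu h hh)
    refine ⟨k, hk, fun k' hk' => toHom_injective fun y => ?_⟩
    obtain ⟨x, rfl⟩ := hs y
    rw [← toHom_comp, ← toHom_comp, hk, show q ≫ k' = h from hk']

/-! ### Quotient algebras and free algebras -/

/-- The quotient of a structure by a congruence whose quotient satisfies the identities. -/
def quotAlg (V : Variety L) (M : Type (max u w)) [L.Structure M] (s : Setoid M)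
    (hs : ∀ ⦃n : ℕ⦄ (φ : L.Functions n) (x y : Fin n → M), (∀ i, s (x i) (y i)) →
      s (funMap φ x) (funMap φ y))
    (hV : ∀ e ∈ V.identities, ∀ x : ℕ → M, s (e.1.realize x) (e.2.realize x)) :
    Alg.{u, v, w} V :=
  letI : L.Prestructure s :=
    { toStructure := inferInstance
      fun_equiv := fun x y h => hs _ x y h
      rel_equiv := fun {_} {r} => isEmptyElim r }
  { carrier := Quotient s
    holds := by
      intro e he x
      obtain ⟨y, rfl⟩ : ∃ y : ℕ → M, (fun i => (⟦y i⟧ : Quotient s)) = x :=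
        ⟨fun i => (x i).out, funext fun i => Quotient.out_eq _⟩
      rw [Term.realize_quotient_mk', Term.realize_quotient_mk']
      exact Quotient.sound (hV e he y) }

section quotAlg

variable {M : Type (max u w)} [L.Structure M] {s : Setoid M}
    {hs : ∀ ⦃n : ℕ⦄ (φ : L.Functions n) (x y : Fin n → M), (∀ i, s (x i) (y i)) →
      s (funMap φ x) (funMap φ y)}
    {hV : ∀ e ∈ V.identities, ∀ x : ℕ → M, s (e.1.realize x) (e.2.realize x)}

/-- The class of an element in the quotient algebra. -/
def quotMk (x : M) : quotAlg.{u, v, w} V M s hs hV := (Quotient.mk s x : Quotient s)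

theorem quotMk_eq_iff {x y : M} :
    (quotMk x : quotAlg.{u, v, w} V M s hs hV) = quotMk y ↔ s x y :=
  Quotient.eq

theorem quotMk_surjective :
    Function.Surjective (quotMk : M → quotAlg.{u, v, w} V M s hs hV) :=
  fun x => Quotient.exists_rep x

theorem funMap_quotMk {n : ℕ} (φ : L.Functions n) (x : Fin n → M) :
    (funMap φ fun i => (quotMk (x i) : quotAlg.{u, v, w} V M s hs hV)) = quotMk (funMap φ x) :=
  letI : L.Prestructure s :=
    { toStructure := inferInstance
      fun_equiv := fun x y h => hs _ x y h
      rel_equiv := fun {_} {r} => isEmptyElim r }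
  funMap_quotient_mk' s φ x

end quotAlg

/-- The algebra of terms, whose operations are formal. -/
@[reducible] def termStructure (α : Type w) : L.Structure (L.Term α) where
  funMap φ ts := Term.func φ ts
  RelMap r := isEmptyElim r

theorem realize_termStructure {α : Type w} {β : Type*} (t : L.Term β) (x : β → L.Term α) :
    letI : L.Structure (L.Term α) := termStructure α
    t.realize x = t.subst x := by
  let : L.Structure (L.Term α) := termStructure α
  induction t with
  | var => rfl
  | func φ ts ih => exact congrArg (Term.func φ) (funext ih)

/-- Two terms are identified when they take the same value in all algebras of the variety. -/
def validSetoid (V : Variety L) (α : Type (max u w)) : Setoid (L.Term α) where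
  r s t := ∀ (A : Alg.{u, v, w} V) (x : α → A), s.realize x = t.realize x
  iseqv := ⟨fun _ _ _ => rfl, fun h A x => (h A x).symm, fun h k A x => (h A x).trans (k A x)⟩

/-- The free algebra on `k` generators: terms modulo the identities valid in the variety. The
variables are lifted so that the terms live in the universe of the carriers. -/
def freeAlg (V : Variety L) (k : ℕ) : Alg.{u, v, w} V :=
  letI : L.Structure (L.Term (ULift.{max u w} (Fin k))) := termStructure _
  quotAlg.{u, v, w} V (L.Term (ULift.{max u w} (Fin k))) (validSetoid.{u, v, w} V _)
    (fun _ φ x y h A a => congrArg (funMap φ) (funext fun i => h i A a))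
    (fun e he x A a => by
      rw [realize_termStructure, realize_termStructure, Term.realize_subst, Term.realize_subst]
      exact A.holds e he _)

/-- The free generators. -/
def freeGen (V : Variety L) (k : ℕ) (i : Fin k) : freeAlg.{u, v, w} V k :=
  letI : L.Structure (L.Term (ULift.{max u w} (Fin k))) := termStructure _
  quotMk (Term.var ⟨i⟩)

theorem exists_realize_freeGen {k : ℕ} (x : freeAlg.{u, v, w} V k) :
    ∃ t : L.Term (Fin k), t.realize (freeGen.{u, v, w} V k) = x := by
  let : L.Structure (L.Term (ULift.{max u w} (Fin k))) := termStructure _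
  obtain ⟨t, rfl⟩ := quotMk_surjective x
  refine ⟨t.relabel ULift.down, ?_⟩
  rw [Term.realize_relabel]
  induction t with
  | var => rfl
  | func φ ts ih =>
    rw [Term.realize_func]
    simp only [ih]
    exact funMap_quotMk φ ts

theorem exists_hom_freeAlg {k : ℕ} {A : Alg.{u, v, w} V} (a : Fin k → A) :
    ∃ f : freeAlg.{u, v, w} V k ⟶ A, ∀ i, toHom f (freeGen V k i) = a i := by
  let : L.Structure (L.Term (ULift.{max u w} (Fin k))) := termStructure _
  let F : freeAlg.{u, v, w} V k → A :=
    Quotient.lift (s := validSetoid.{u, v, w} V _) (fun t => t.realize fun i => a i.down)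
      fun s t h => h A _
  refine ⟨ofFun F fun n φ x => ?_, fun i => rfl⟩
  choose t ht using fun i => quotMk_surjective (x i)
  obtain rfl : (fun i => quotMk (t i)) = x := funext ht
  exact congrArg F (funMap_quotMk φ t)

theorem freeAlg_hom_ext {k : ℕ} {A : Alg.{u, v, w} V} {f g : freeAlg.{u, v, w} V k ⟶ A}
    (h : ∀ i, toHom f (freeGen V k i) = toHom g (freeGen V k i)) : f = g := by
  refine toHom_injective fun x => ?_
  obtain ⟨t, rfl⟩ := exists_realize_freeGen x
  rw [toHom_realize, toHom_realize]
  simp only [h]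

/-! ### From products of coequalizers to the terms -/

/-- Identifying the two generators of the free algebra on two generators gives the free algebra
on one generator. -/
theorem isCoequalizerDiagram_freeAlg {f g : freeAlg.{u, v, w} V 1 ⟶ freeAlg.{u, v, w} V 2}
    {q : freeAlg.{u, v, w} V 2 ⟶ freeAlg.{u, v, w} V 1}
    (hf : toHom f (freeGen V 1 0) = freeGen V 2 0) (hg : toHom g (freeGen V 1 0) = freeGen V 2 1)
    (hq : ∀ i, toHom q (freeGen V 2 i) = freeGen V 1 0) : IsCoequalizerDiagram f g q := by
  have hfq : f ≫ q = 𝟙 _ := freeAlg_hom_ext fun i => by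
    rw [Subsingleton.elim i 0, toHom_comp, hf, hq, toHom_id]
  have hgq : g ≫ q = 𝟙 _ := freeAlg_hom_ext fun i => by
    rw [Subsingleton.elim i 0, toHom_comp, hg, hq, toHom_id]
  rw [isCoequalizerDiagram_iff_existsUnique]
  refine ⟨hfq.trans hgq.symm, fun Z h hh => ⟨f ≫ h, freeAlg_hom_ext fun i => ?_, fun k hk => ?_⟩⟩
  · rw [toHom_comp, hq]
    fin_cases i
    · rw [toHom_comp, hf]; rfl
    · rw [hh, toHom_comp, hg]; rfl
  · rw [← show q ≫ k = h from hk, ← Category.assoc, hfq, Category.id_comp]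

theorem isCoequalizerDiagram_id {C : Type u} [Category.{v} C] {K X : C} (f : K ⟶ X) :
    IsCoequalizerDiagram f f (𝟙 X) := by
  rw [isCoequalizerDiagram_iff_existsUnique]
  exact ⟨rfl, fun Z h _ => ⟨h, Category.id_comp h, fun k hk => by
    rw [← show 𝟙 X ≫ k = h from hk, Category.id_comp]⟩⟩

/-- With `x, y` and `z` the generators of the free algebras on two and one generators, property
(P) puts `((x, z), (y, z))` into the congruence generated by `((x, 0), (y, 0))`. -/
theorem swapSetoid_of_productsPreserveCoequalizers {o : L.Term Empty}
    (ho : IsUniqueConstant.{u, v, w} V o)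
    (hP : ProductsPreserveCoequalizers (Alg.{u, v, w} V)) :
    swapSetoid (A := prodAlg (freeAlg.{u, v, w} V 2) (freeAlg.{u, v, w} V 1))
      (freeGen V 2 0, const o _) (freeGen V 2 1, const o _)
      (freeGen V 2 0, freeGen V 1 0) (freeGen V 2 1, freeGen V 1 0) := by
  obtain ⟨f, hf⟩ := exists_hom_freeAlg (k := 1) fun _ => freeGen.{u, v, w} V 2 0
  obtain ⟨g, hg⟩ := exists_hom_freeAlg (k := 1) fun _ => freeGen.{u, v, w} V 2 1
  obtain ⟨q, hq⟩ := exists_hom_freeAlg (k := 2) fun _ => freeGen.{u, v, w} V 1 0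
  have hcoeq := hP f g q _ _ _ (isCoequalizerDiagram_freeAlg (hf 0) (hg 0) hq)
    (isCoequalizerDiagram_id (zeroHom ho (freeAlg V 1) (freeAlg V 1)))
  rw [isCoequalizerDiagram_prodMap_iff, isCoequalizerDiagram_iff] at hcoeq
  let A := prodAlg (freeAlg.{u, v, w} V 2) (freeAlg.{u, v, w} V 1)
  let α : A := (freeGen V 2 0, const o _)
  let β : A := (freeGen V 2 1, const o _)
  let Q : Alg.{u, v, w} V := quotAlg.{u, v, w} V A (swapSetoid α β) (swapSetoid_funMap α β)
    fun e he x => by rw [A.holds e he x]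
  let π : A ⟶ Q := ofFun (fun a => quotMk a) fun n φ x => (funMap_quotMk φ x).symm
  refine quotMk_eq_iff.1 (hcoeq.2.2 π (toHom_injective fun c => ?_) _ _ ?_)
  · refine quotMk_eq_iff.2 (SwapRel.swapSetoid ?_)
    obtain ⟨t, ht⟩ := exists_realize_freeGen c.1
    have key : ∀ (k : freeAlg.{u, v, w} V 1 ⟶ freeAlg.{u, v, w} V 2) (a : freeAlg.{u, v, w} V 2),
        (∀ i, toHom k (freeGen V 1 i) = a) →
        t.realize (M := A) (fun _ => (a, const o _)) = (toHom k c.1, const o _) := by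
      intro k a hk
      refine (realize_prodAlg t _).trans (Prod.ext ?_ (realize_const ho _ t))
      change (t.realize fun _ => a) = toHom k c.1
      rw [← ht, toHom_realize]
      simp only [hk]
    refine ⟨t.relabel fun _ => Sum.inr 0, ?_, ?_⟩
    · rw [Term.realize_relabel]
      exact key f _ hf
    · rw [Term.realize_relabel]
      exact key g _ hg
  · exact Prod.ext ((hq 0).trans (hq 1).symm) rfl

theorem exists_terms_of_productsPreserveCoequalizers {o : L.Term Empty}
    (ho : IsUniqueConstant.{u, v, w} V o)
    (hP : ProductsPreserveCoequalizers (Alg.{u, v, w} V)) :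
    ∃ (m n : ℕ) (b : Fin m → L.Term (Fin 2)) (c : Fin m → L.Term (Fin 1))
      (p : Fin (n + 1) → L.Term (Fin (m + 2))),
      ∀ A : Variety.Alg.{u, v, w} V,
        (∀ x y : A,
          (p 0).realize (Matrix.vecCons x (Matrix.vecCons y
            fun j => (b j).realize ![x, y])) = x) ∧
        (∀ (i : Fin n) (x y : A),
          (p i.castSucc).realize (Matrix.vecCons y (Matrix.vecCons x
              fun j => (b j).realize ![x, y])) =
            (p i.succ).realize (Matrix.vecCons x (Matrix.vecCons y
              fun j => (b j).realize ![x, y]))) ∧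
        (∀ x y : A,
          (p (Fin.last n)).realize (Matrix.vecCons y (Matrix.vecCons x
            fun j => (b j).realize ![x, y])) = y) ∧
        (∀ (i : Fin (n + 1)) (z : A),
          (p i).realize (Matrix.vecCons (Variety.const o A) (Matrix.vecCons
            (Variety.const o A) fun j => (c j).realize ![z])) = z) := by
  obtain ⟨s, hs0, hs, n, hn⟩ := swapSetoid_of_productsPreserveCoequalizers ho hP
  choose P hP1 hP2 using hs
  obtain ⟨m, d, p, hp⟩ := exists_common_parameters fun i : Fin (n + 1) => P i
  choose b hb using fun j => exists_realize_freeGen (d j).1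
  choose c hc using fun j => exists_realize_freeGen (d j).2
  have hp1 : ∀ i : Fin (n + 1), _ = s i := fun i => (hp i _ _).trans (hP1 i)
  have hp2 : ∀ i : Fin (n + 1), _ = s (i + 1) := fun i => (hp i _ _).trans (hP2 i)
  -- The homomorphism `F` that sends the free generators to `x` and `y` carries the first
  -- coordinates of the chain `s` to the values of the terms `p i` in `A`.
  have ev : ∀ (A : Alg.{u, v, w} V) (x y : A), ∃ F : freeAlg.{u, v, w} V 2 ⟶ A,
      (∀ i : Fin (n + 1), (p i).realize (Matrix.vecCons x (Matrix.vecCons y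
        fun j => (b j).realize ![x, y])) = toHom F (s i).1) ∧
      (∀ i : Fin (n + 1), (p i).realize (Matrix.vecCons y (Matrix.vecCons x
        fun j => (b j).realize ![x, y])) = toHom F (s (i + 1)).1) ∧
      toHom F (freeGen V 2 0) = x ∧ toHom F (freeGen V 2 1) = y := by
    intro A x y
    obtain ⟨F, hF⟩ := exists_hom_freeAlg ![x, y]
    have hF' : (fun i => toHom F (freeGen V 2 i)) = ![x, y] := funext hF
    have hd : ∀ j, toHom F (d j).1 = (b j).realize ![x, y] := fun j => by
      rw [← hb, toHom_realize, hF']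
    refine ⟨F, fun i => ?_, fun i => ?_, hF 0, hF 1⟩
    · rw [← hp1, realize_prodAlg, toHom_realize]
      congr 1
      funext k
      exact Fin.cases (hF 0).symm (fun k => Fin.cases (hF 1).symm (fun k => (hd k).symm) k) k
    · rw [← hp2, realize_prodAlg, toHom_realize]
      congr 1
      funext k
      exact Fin.cases (hF 1).symm (fun k => Fin.cases (hF 0).symm (fun k => (hd k).symm) k) k
  -- The second coordinate is constant along the chain: the two swapped elements, `(x, 0)` and
  -- `(y, 0)`, have the same second coordinate.
  have hsnd : ∀ i, i ≤ n + 1 → (s i).2 = freeGen V 1 0 := by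
    intro i
    induction i with
    | zero => intro _; rw [hs0]
    | succ i ih =>
      intro hi
      rw [← ih (by omega), ← hp1 ⟨i, by omega⟩, ← hp2 ⟨i, by omega⟩, realize_prodAlg,
        realize_prodAlg]
      change Term.realize _ _ = Term.realize _ _
      congr 1
      funext k
      exact Fin.cases rfl (fun k => Fin.cases rfl (fun k => rfl) k) k
  refine ⟨m, n, b, c, p, fun A => ⟨fun x y => ?_, fun i x y => ?_, fun x y => ?_, fun i z => ?_⟩⟩
  · obtain ⟨F, h1, -, hx, -⟩ := ev A x y
    rw [h1, Fin.val_zero, hs0, hx]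
  · obtain ⟨F, h1, h2, -, -⟩ := ev A x y
    rw [h1, h2]
    rfl
  · obtain ⟨F, -, h2, -, hy⟩ := ev A x y
    rw [h2, hn _ (by simp), hy]
  · obtain ⟨F, hF⟩ := exists_hom_freeAlg ![z]
    have hF' : (fun i => toHom F (freeGen V 1 i)) = ![z] := funext hF
    have hd : ∀ j, toHom F (d j).2 = (c j).realize ![z] := fun j => by
      rw [← hc, toHom_realize, hF']
    have hz : toHom F (s i).2 = z := by rw [hsnd i (by omega)]; exact hF 0
    refine Eq.trans ?_ hz
    rw [← hp1, realize_prodAlg, toHom_realize]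
    congr 1
    funext k
    exact Fin.cases (toHom_const F o).symm
      (fun k => Fin.cases (toHom_const F o).symm (fun k => (hd k).symm) k) k

end Variety

theorem mainTheorem1 {L : FirstOrder.Language.{u, v}} [L.IsAlgebraic] (V : Variety L)
    (o : L.Term Empty) (ho : Variety.IsUniqueConstant.{u, v, w} V o) :
    ProductsPreserveCoequalizers (Variety.Alg.{u, v, w} V) ↔
      ∃ (m n : ℕ) (b : Fin m → L.Term (Fin 2)) (c : Fin m → L.Term (Fin 1))
        (p : Fin (n + 1) → L.Term (Fin (m + 2))),
        ∀ A : Variety.Alg.{u, v, w} V,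
          (∀ x y : A,
            (p 0).realize (Matrix.vecCons x (Matrix.vecCons y
              fun j => (b j).realize ![x, y])) = x) ∧
          (∀ (i : Fin n) (x y : A),
            (p i.castSucc).realize (Matrix.vecCons y (Matrix.vecCons x
                fun j => (b j).realize ![x, y])) =
              (p i.succ).realize (Matrix.vecCons x (Matrix.vecCons y
                fun j => (b j).realize ![x, y]))) ∧
          (∀ x y : A,
            (p (Fin.last n)).realize (Matrix.vecCons y (Matrix.vecCons x
              fun j => (b j).realize ![x, y])) = y) ∧
          (∀ (i : Fin (n + 1)) (z : A),
            (p i).realize (Matrix.vecCons (Variety.const o A) (Matrix.vecCons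
              (Variety.const o A) fun j => (c j).realize ![z])) = z) := by
  refine ⟨Variety.exists_terms_of_productsPreserveCoequalizers ho, ?_⟩
  rintro ⟨m, n, b, c, p, hT⟩ C₁ X X' C₂ Y Y' f g q₁ f' g' q₂ h₁ h₂
  have transfer : ∀ {A B Z : Variety.Alg.{u, v, w} V} (h : Variety.prodAlg A B ⟶ Z) {x x' : A},
      Variety.toHom h (x, Variety.const o B) = Variety.toHom h (x', Variety.const o B) →
      ∀ y : B, Variety.toHom h (x, y) = Variety.toHom h (x', y) := fun {A B Z} h x x' hx y =>
    Variety.toHom_eq_of_terms o b c p (hT A).1 (hT A).2.1 (hT A).2.2.1 (hT B).2.2.2 h hx y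
  rw [Variety.isCoequalizerDiagram_prodMap_iff]
  rw [Variety.isCoequalizerDiagram_iff] at h₁ h₂ ⊢
  obtain ⟨e₁, s₁, u₁⟩ := h₁
  obtain ⟨e₂, s₂, u₂⟩ := h₂
  refine ⟨?_, ?_, ?_⟩
  · exact Variety.toHom_injective fun a => Prod.ext
      (congrArg (fun k => Variety.toHom k a.1) e₁) (congrArg (fun k => Variety.toHom k a.2) e₂)
  · rintro ⟨x', y'⟩
    obtain ⟨x, rfl⟩ := s₁ x'
    obtain ⟨y, rfl⟩ := s₂ y'
    exact ⟨(x, y), rfl⟩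
  · rintro Z h hh ⟨x, y⟩ ⟨x', y'⟩ hxy
    have hx : Variety.toHom q₁ x = Variety.toHom q₁ x' := congrArg Prod.fst hxy
    have hy : Variety.toHom q₂ y = Variety.toHom q₂ y' := congrArg Prod.snd hxy
    have hpair : ∀ (a : C₁) (a' : C₂),
        Variety.toHom h (Variety.toHom f a, Variety.toHom f' a') =
          Variety.toHom h (Variety.toHom g a, Variety.toHom g' a') := fun a a' =>
      congrArg (fun k => Variety.toHom k (a, a')) hh
    -- `h (-, 0)` coequalizes `f` and `g`, because `f'` and `g'` both send `0` to `0`.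
    have hx0 : Variety.toHom h (x, Variety.const o Y) = Variety.toHom h (x', Variety.const o Y) := by
      refine u₁ (Variety.prodLift (𝟙 X) (Variety.zeroHom ho X Y) ≫ h)
        (Variety.toHom_injective fun a => ?_) x x' hx
      have := hpair a (Variety.const o C₂)
      rwa [Variety.toHom_const, Variety.toHom_const] at this
    have hy0 : Variety.toHom h (Variety.const o X, y) = Variety.toHom h (Variety.const o X, y') := by
      refine u₂ (Variety.prodLift (Variety.zeroHom ho Y X) (𝟙 Y) ≫ h)
        (Variety.toHom_injective fun a => ?_) y y' hy
      have := hpair (Variety.const o C₁) a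
      rwa [Variety.toHom_const, Variety.toHom_const] at this
    exact (transfer h hx0 y).trans
      (transfer (Variety.prodLift (Variety.prodSnd Y X) (Variety.prodFst Y X) ≫ h) hy0 x')
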